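/- A totally-ordered multiple knapsack set (TOMKS) is a set $K=\{x\in\{0,1\}^n \mid Ax\le b\}$, where $A\in\mathbb Z_{+}^{m\times n}$ and $b\in\mathbb Z_{+}^{m}$ have nonnegative integer entries and the columns of $A$ satisfy $A_{\cdot 1}\ge A_{\cdot 2}\ge\dots\ge A_{\cdot n}$ componentwise. A set $S\subseteq[n]=\{1,\dots,n\}$ is a cover for $K$ if its incidence vector $\chi^S$ is not in $K$; the minimal cover set of $K$ is the set of all inclusion-minimal covers. **Theorem.** Let $1\le p\le q-2$ and $q\le n$, and let $K$ be a TOMKS whose minimal cover set is $$\bigl\{\{1,\dots,p-1,p+1,\dots,q\}\bigr\}\cup\bigl\{\{1,\dots,p,i\} : i=p+1,\dots,q\bigr\}.$$ Then $\operatorname{conv}(K)$ is exactly the set of all $x\in\mathbb R^n$ that satisfy - the bound constraints $0\le x_i\le 1$ for $i=1,\dots,n$; - the cover inequalities $\sum_{i=1}^{p}x_i+x_j\le p$ for $j=p+1,\dots,q$, and $\sum_{i=1}^{p-1}x_i+\sum_{i=p+1}^{q}x_i\le q-2$; - the inequality $(q-p)\sum_{i=1}^{p-1}x_i+(q-p-1)\,x_p+\sum_{i=p+1}^{q}x_i\le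 p(q-p)-1.$ Moreover, if $q\ge p+3$, the last inequality is a multi-cover inequality (MCI) for $K$ in the following sense. For $S_1,S_2\subseteq[n]$, $S_1$ dominates $S_2$ if there is an injection $f:S_2\to S_1$ with $f(i)\le i$ for all $i\in S_2$. For a nonempty family $\mathscr C=\{C_1,\dots,C_k\}$ of covers for $K$, let $C_0=\bigcap_h C_h$, $C=\bigcup_h C_h$ and $\bar C_h=C\setminus C_h$. The family is a multi-cover if every $T\subseteq C\setminus C_0$ that is not one of the sets $C_h\setminus C_0$ dominates, or is dominated by, some $C_h\setminus C_0$. An inequality $\sum_i\alpha_ix_i\le\beta$ is an MCI for $K$ if, for some multi-cover, the $\alpha_i$ are integers with $\alpha_i=0$ for $i\notin C$; $\alpha_i=1$ for $i=\max(C\setminus C_0)$ (if $C \ne C_0$); $\alpha_i\ge\max_{h:\,i\in C_h}\max_{\ell\in\bar C_h,\,\ell>i}\alpha_\ell+1$ for every other $i\in C\setminus C_0$; $\alpha_j\ge\min_{h}\max\bigl\{\max_{\ell\in\bar C_h,\,\ell<j}\alpha_\ell,\ \sum_{\ell\in\bar C_h,\,\ell>j}\alpha_\ell+1\bigr\}$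 for every $j\in C_0$; and $\beta=\max_h\sum_{i\in C_h}\alpha_i-1$. Here a maximum over the empty set is $0$. -/

import Mathlib

/-- `K` is a totally-ordered multiple knapsack set `{x ∈ {0,1}ⁿ | A x ≤ b}`: `A` and `b` have
nonnegative integer entries and the columns of `A` satisfy `A_{·1} ≥ A_{·2} ≥ ⋯ ≥ A_{·n}`
componentwise. -/
def IsTOMKS {n : ℕ} (K : Set (Fin n → ℝ)) : Prop :=
  ∃ (m : ℕ) (A : Matrix (Fin m) (Fin n) ℕ) (b : Fin m → ℕ),
    (∀ i j : Fin n, i ≤ j → ∀ r : Fin m, A r j ≤ A r i) ∧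
    K = {x : Fin n → ℝ | (∀ i, x i = 0 ∨ x i = 1) ∧
      ∀ r : Fin m, ∑ i, (A r i : ℝ) * x i ≤ (b r : ℝ)}

/-- The incidence vector of a set of indices. -/
def incidence {n : ℕ} (S : Finset (Fin n)) : Fin n → ℝ := fun i => if i ∈ S then 1 else 0

/-- `S` is a cover for `K` if its incidence vector is not in `K`. -/
def IsCover {n : ℕ} (K : Set (Fin n → ℝ)) (S : Finset (Fin n)) : Prop := incidence S ∉ K

/-- The set of inclusion-minimal covers for `K`. -/
def minimalCoverSet {n : ℕ} (K : Set (Fin n → ℝ)) : Set (Finset (Fin n)) :=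
  {C | Minimal (IsCover K) C}

/-- The index set `{a, a + 1, …, b} ∩ [n]`, where `[n] = {1, …, n}` is numbered from one: the
element `i : Fin n` is the index `i + 1`. -/
def block {n : ℕ} (a b : ℕ) : Finset (Fin n) :=
  Finset.univ.filter fun i => a ≤ (i : ℕ) + 1 ∧ (i : ℕ) + 1 ≤ b

/-- `S₁` dominates `S₂`: there is an injection `f : S₂ → S₁` with `f i ≤ i`. -/
def Dominates {n : ℕ} (S₁ S₂ : Finset (Fin n)) : Prop :=
  ∃ f : S₂ → S₁, Function.Injective f ∧ ∀ i : S₂, (f i : Fin n) ≤ (i : Fin n)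

/-- The intersection `C₀` of the members of a family. -/
def familyInter {n : ℕ} (F : Finset (Finset (Fin n))) : Finset (Fin n) := F.inf id

/-- The union `C` of the members of a family. -/
def familyUnion {n : ℕ} (F : Finset (Finset (Fin n))) : Finset (Fin n) := F.sup id

/-- The discrepancy family `{C_h \ C₀}` of a family `{C_h}`. -/
def discrepancyFamily {n : ℕ} (F : Finset (Finset (Fin n))) : Finset (Finset (Fin n)) :=
  F.image fun D => D \ familyInter F

/-- A multi-cover for `K`: a (nonempty, finite) family of covers such that every subset of the
union of the discrepancy family that is not itself in the discrepancy family is comparable,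
in the dominance order, with some member of the discrepancy family. -/
def IsMultiCover {n : ℕ} (K : Set (Fin n → ℝ)) (F : Finset (Finset (Fin n))) : Prop :=
  F.Nonempty ∧ (∀ D ∈ F, IsCover K D) ∧
    ∀ T : Finset (Fin n), T ⊆ familyUnion (discrepancyFamily F) → T ∉ discrepancyFamily F →
      ∃ D ∈ discrepancyFamily F, Dominates T D ∨ Dominates D T

/-- `∑ α_i x_i ≤ β` is one of the multi-cover inequalities that the multi-cover algorithm can
return on the family `F`. With `C` the union and `C₀` the intersection of `F`:
* `α` vanishes outside `C`, and `α = 1` at the largest element of `C \ C₀`;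
* for every other `i ∈ C \ C₀`,
  `α_i` is any integer `≥ max_{D ∈ F, i ∈ D} max_{ℓ ∈ C \ D, ℓ > i} α_ℓ + 1`;
* for `j ∈ C₀`, `α_j` is any integer
  `≥ min_{D ∈ F} max (max_{ℓ ∈ C \ D, ℓ < j} α_ℓ) (∑_{ℓ ∈ C \ D, ℓ > j} α_ℓ + 1)`;
* `β = max_{D ∈ F} α(D) - 1`.
The maximum over an empty set is `0`, which is `Finset.sup` in `ℕ`. -/
def IsMCIOf {n : ℕ} (F : Finset (Finset (Fin n))) (hF : F.Nonempty) (α : Fin n → ℕ) (β : ℤ) :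
    Prop :=
  (∀ i, i ∉ familyUnion F → α i = 0) ∧
  (∀ i ∈ familyUnion F \ familyInter F,
    (∀ ℓ ∈ familyUnion F \ familyInter F, ℓ ≤ i) → α i = 1) ∧
  (∀ i ∈ familyUnion F \ familyInter F,
    (∃ ℓ ∈ familyUnion F \ familyInter F, i < ℓ) →
      (F.filter fun D => i ∈ D).sup
        (fun D => ((familyUnion F \ D).filter fun ℓ => i < ℓ).sup α) + 1 ≤ α i) ∧
  (∀ j ∈ familyInter F,
    F.inf' hF (fun D =>
      max (((familyUnion F \ D).filter fun ℓ => ℓ < j).sup α)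
        ((∑ ℓ ∈ (familyUnion F \ D).filter (fun ℓ => j < ℓ), α ℓ) + 1)) ≤ α j) ∧
  β = ((F.sup fun D => ∑ i ∈ D, α i : ℕ) : ℤ) - 1

/-- `∑ α_i x_i ≤ β` is a multi-cover inequality (MCI) for `K`. -/
def IsMCI {n : ℕ} (K : Set (Fin n → ℝ)) (α : Fin n → ℕ) (β : ℤ) : Prop :=
  ∃ (F : Finset (Finset (Fin n))) (hF : IsMultiCover K F), IsMCIOf F hF.1 α β

/-- The linear form `(q - p) ∑_{i < p} x_i + (q - p - 1) x_p + ∑_{i = p + 1}^q x_i`. -/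
def mciForm {n : ℕ} (p q : ℕ) (x : Fin n → ℝ) : ℝ :=
  ((q : ℝ) - p) * (∑ i ∈ block 1 (p - 1), x i) + ((q : ℝ) - p - 1) * (∑ i ∈ block p p, x i)
    + ∑ i ∈ block (p + 1) q, x i

/-! Put `B = {1, …, p-1}`, `e = p`, `R = {p+1, …, q}`. A 0/1 point avoids all the covers exactly
when it has a zero in `B`, or has `x e = 0` and a zero in `R`, or vanishes on `R`. So `K` is a union
of three sets, each consisting of the 0/1 points of a cube face cut by at most one cardinality
bound; such polytopes are integral (`cardinalityPolytope_subset_convexHull`).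

The listed inequalities hold on each of the three sets. Conversely, `mem_convexHull_of_threeKinds`
writes a point `x` satisfying them as `u v + t w + a z`, one point of each kind. The weight `u` is
the total deficiency of `x` on `B`, and `v` absorbs all of it. What `v` cannot carry at `e` forces
the weight `a` of `z`, and `w` takes the excess on `R` with the remaining weight `t = 1 - u - a`.
The inequalities are what makes `w` feasible.

The MCI claim uses the family `{1, …, p-1, p+1, …, q}`, `{1, …, p, q}`, whose discrepancies are
`{p+1, …, q-1}` and `{p}`. -/

/-! ### Integrality of a cube face with one cardinality bound. -/

/-- The polytope cut out of the unit cube by vanishing on `T` and a cardinality bound on `S`. -/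
def cardinalityPolytope {ι : Type*} (S T : Finset ι) (k : ℕ) : Set (ι → ℝ) :=
  {x | (∀ i, 0 ≤ x i ∧ x i ≤ 1) ∧ (∀ i ∈ T, x i = 0) ∧ ∑ i ∈ S, x i ≤ k}

theorem isCompact_cardinalityPolytope {ι : Type*} [Fintype ι] (S T : Finset ι) (k : ℕ) :
    IsCompact (cardinalityPolytope S T k) := by
  have hc : IsCompact (Set.pi Set.univ fun _ : ι => Set.Icc (0 : ℝ) 1) :=
    isCompact_univ_pi fun _ => isCompact_Icc
  have h : cardinalityPolytope S T k =
      (Set.pi Set.univ fun _ : ι => Set.Icc (0 : ℝ) 1) ∩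
        ((⋂ i ∈ T, {x : ι → ℝ | x i = 0}) ∩ {x : ι → ℝ | ∑ i ∈ S, x i ≤ k}) := by
    ext x
    simp only [cardinalityPolytope, Set.mem_ofPred_eq, Set.mem_inter_iff, Set.mem_pi, Set.mem_univ,
      forall_const, Set.mem_Icc, Set.mem_iInter]
  rw [h]
  refine hc.inter_right (IsClosed.inter ?_ ?_)
  · exact isClosed_biInter fun i _ => isClosed_eq (continuous_apply i) continuous_const
  · exact isClosed_le (continuous_finsetSum _ fun i _ => continuous_apply i) continuous_const

theorem convex_cardinalityPolytope {ι : Type*} (S T : Finset ι) (k : ℕ) :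
    Convex ℝ (cardinalityPolytope S T k) := by
  rintro x ⟨hx, hxT, hxS⟩ y ⟨hy, hyT, hyS⟩ a b ha hb hab
  refine ⟨fun i => ?_, fun i hi => ?_, ?_⟩
  · have := convex_Icc (0 : ℝ) 1 (hx i) (hy i) ha hb hab
    exact this
  · simp [hxT i hi, hyT i hi]
  · simp only [Pi.add_apply, Pi.smul_apply, smul_eq_mul, Finset.sum_add_distrib, ← Finset.mul_sum]
    calc _ ≤ a * (k : ℝ) + b * k := by gcongr
      _ = k := by rw [← add_mul, hab, one_mul]

/-- A point that can be moved within `P` both ways along a nonzero direction is not extreme. -/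
theorem notMem_extremePoints_of_add_sub {ι : Type*} {P : Set (ι → ℝ)} {x d : ι → ℝ} (hd : d ≠ 0)
    (h₁ : x + d ∈ P) (h₂ : x - d ∈ P) : x ∉ P.extremePoints ℝ := by
  intro hx
  have h := hx.2 h₁ h₂ ⟨1 / 2, 1 / 2, by norm_num, by norm_num, by norm_num, by
    ext i
    simp only [Pi.add_apply, Pi.smul_apply, Pi.sub_apply, smul_eq_mul]
    ring⟩
  exact hd (by simpa using h)

/-- Two fractional coordinates in `S` can be traded against each other without changing the sum. A
lone fractional coordinate in `S` cannot make the bound tight, as `k` is an integer; one outside `S`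
does not affect it. -/
theorem extremePoints_cardinalityPolytope {ι : Type*} (S T : Finset ι) (k : ℕ) {x : ι → ℝ}
    (hx : x ∈ (cardinalityPolytope S T k).extremePoints ℝ) (i : ι) : x i = 0 ∨ x i = 1 := by
  classical
  obtain ⟨hc, hT, hS⟩ := hx.1
  by_contra! hi
  have pos : ∀ j, x j ≠ 0 → 0 < x j := fun j hj => lt_of_le_of_ne (hc j).1 hj.symm
  have lt1 : ∀ j, x j ≠ 1 → x j < 1 := fun j hj => lt_of_le_of_ne (hc j).2 hj
  by_cases hij : i ∈ S ∧ ∃ j ∈ S, j ≠ i ∧ x j ≠ 0 ∧ x j ≠ 1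
  · obtain ⟨hiS, j, hjS, hne, hj⟩ := hij
    obtain ⟨ε, hε, hε'⟩ := exists_between (show 0 < min (min (x i) (1 - x i)) (min (x j) (1 - x j))
      by simp [pos i hi.1, lt1 i hi.2, pos j hj.1, lt1 j hj.2])
    simp only [lt_min_iff] at hε'
    obtain ⟨⟨h1, h2⟩, h3, h4⟩ := hε'
    have hsum : ∑ l ∈ S, (Pi.single i ε - Pi.single j ε : ι → ℝ) l = 0 := by
      simp [hiS, hjS]
    refine notMem_extremePoints_of_add_sub (d := Pi.single i ε - Pi.single j ε) ?_ ?_ ?_ hx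
    · intro h
      have := congrFun h i
      simp [hne.symm] at this
      exact hε.ne' this
    · refine ⟨fun l => ?_, fun l hl => ?_, ?_⟩
      · rcases eq_or_ne l i with rfl | hli
        · simp [hne.symm]; constructor <;> linarith
        · rcases eq_or_ne l j with rfl | hlj
          · simp [hne]; constructor <;> linarith
          · simpa [hli, hlj] using hc l
      · have hli : l ≠ i := fun h => hi.1 (h ▸ hT l hl)
        have hlj : l ≠ j := fun h => hj.1 (h ▸ hT l hl)
        simpa [hli, hlj] using hT l hl
      · simp only [Pi.add_apply, Finset.sum_add_distrib, hsum]; linarith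
    · refine ⟨fun l => ?_, fun l hl => ?_, ?_⟩
      · rcases eq_or_ne l i with rfl | hli
        · simp [hne.symm]; constructor <;> linarith
        · rcases eq_or_ne l j with rfl | hlj
          · simp [hne]; constructor <;> linarith
          · simpa [hli, hlj] using hc l
      · have hli : l ≠ i := fun h => hi.1 (h ▸ hT l hl)
        have hlj : l ≠ j := fun h => hj.1 (h ▸ hT l hl)
        simpa [hli, hlj] using hT l hl
      · simp only [Pi.sub_apply x, Finset.sum_sub_distrib x, hsum]; linarith
  · obtain ⟨ε, hε, hε'⟩ := exists_between (show 0 < min (x i) (1 - x i)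
      by simp [pos i hi.1, lt1 i hi.2])
    simp only [lt_min_iff] at hε'
    obtain ⟨h1, h2⟩ := hε'
    -- If `i ∈ S`, the other coordinates in `S` are 0/1, so integrality of `k` leaves room to raise
    -- `x i` as far as 1.
    have hround : ∑ l ∈ S, x l + ∑ l ∈ S, (Pi.single i ε : ι → ℝ) l ≤ k := by
      by_cases hiS : i ∈ S
      · have hint : ∀ j ∈ S.erase i, x j = if x j = 1 then 1 else 0 := by
          intro j hj
          have hj' := Finset.mem_erase.1 hj
          by_cases h : x j = 1
          · simp [h]
          · by_contra h0
            simp only [h, if_false] at h0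
            exact hij ⟨hiS, j, hj'.2, hj'.1, h0, h⟩
        have hsum := Finset.sum_congr rfl hint
        rw [Finset.sum_boole] at hsum
        rw [← Finset.add_sum_erase _ _ hiS, hsum] at hS ⊢
        have hlt : ((S.erase i).filter fun j => x j = 1).card < k := by
          have := pos i hi.1
          exact_mod_cast (by linarith :
            (((S.erase i).filter fun j => x j = 1).card : ℝ) < (k : ℝ))
        have hle : (((S.erase i).filter fun j => x j = 1).card : ℝ) + 1 ≤ k := by
          exact_mod_cast hlt
        rw [Finset.sum_pi_single']
        simp only [hiS, if_true]
        linarith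
      · simpa [hiS] using hS
    have hnn : 0 ≤ ∑ l ∈ S, (Pi.single i ε : ι → ℝ) l := by
      rw [Finset.sum_pi_single']; split_ifs <;> linarith
    refine notMem_extremePoints_of_add_sub (d := Pi.single i ε) (by simpa using hε.ne') ?_ ?_ hx
    · refine ⟨fun l => ?_, fun l hl => ?_, ?_⟩
      · rcases eq_or_ne l i with rfl | hli
        · simp; constructor <;> linarith
        · simpa [hli] using hc l
      · have hli : l ≠ i := fun h => hi.1 (h ▸ hT l hl)
        simpa [hli] using hT l hl
      · simpa only [Pi.add_apply, Finset.sum_add_distrib] using hround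
    · refine ⟨fun l => ?_, fun l hl => ?_, ?_⟩
      · rcases eq_or_ne l i with rfl | hli
        · simp; constructor <;> linarith
        · simpa [hli] using hc l
      · have hli : l ≠ i := fun h => hi.1 (h ▸ hT l hl)
        simpa [hli] using hT l hl
      · simp only [Pi.sub_apply, Finset.sum_sub_distrib]; linarith

/-- The cardinality polytope is the convex hull of its `0/1` points. -/
theorem cardinalityPolytope_subset_convexHull {ι : Type*} [Fintype ι] (S T : Finset ι) (k : ℕ) :
    cardinalityPolytope S T k ⊆
      convexHull ℝ {x | (∀ i, x i = 0 ∨ x i = 1) ∧ (∀ i ∈ T, x i = 0) ∧ ∑ i ∈ S, x i ≤ k} := by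
  have hfin : {x : ι → ℝ | (∀ i, x i = 0 ∨ x i = 1) ∧ (∀ i ∈ T, x i = 0) ∧
      ∑ i ∈ S, x i ≤ k}.Finite := by
    refine (Set.Finite.pi' (t := fun _ : ι => ({0, 1} : Set ℝ)) fun _ => by simp).subset ?_
    rintro x ⟨hx, -⟩ i
    simpa using hx i
  rw [← closure_convexHull_extremePoints (isCompact_cardinalityPolytope S T k)
    (convex_cardinalityPolytope S T k)]
  refine closure_minimal (convexHull_mono fun x hx => ?_) (hfin.isClosed_convexHull ℝ)
  exact ⟨extremePoints_cardinalityPolytope S T k hx, hx.1.2⟩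

/-! ### The convex hull of the union of the three kinds. -/

/-- Points of the polytope with vertices of three kinds: one zero in `B`, or a zero at `e` and one
in `R`, or zero on `R`. -/
theorem mem_convexHull_of_threeKinds {ι : Type*} [Fintype ι] {K : Set (ι → ℝ)}
    (B R : Finset ι) (e : ι) (heB : e ∉ B) (heR : e ∉ R) (hBR : Disjoint B R) (hR : R.Nonempty)
    (hK₁ : ∀ x : ι → ℝ, (∀ i, x i = 0 ∨ x i = 1) → ∑ i ∈ B, x i + 1 ≤ B.card → x ∈ K)
    (hK₂ : ∀ x : ι → ℝ, (∀ i, x i = 0 ∨ x i = 1) → x e = 0 → ∑ i ∈ R, x i + 1 ≤ R.card → x ∈ K)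
    (hK₃ : ∀ x : ι → ℝ, (∀ i, x i = 0 ∨ x i = 1) → (∀ i ∈ R, x i = 0) → x ∈ K)
    (x : ι → ℝ) (hc : ∀ i, 0 ≤ x i ∧ x i ≤ 1)
    (h₁ : ∀ j ∈ R, ∑ i ∈ B, x i + x e + x j ≤ B.card + 1)
    (h₂ : ∑ i ∈ B, x i + ∑ i ∈ R, x i ≤ B.card + R.card - 1)
    (h₃ : R.card * ∑ i ∈ B, x i + (R.card - 1) * x e + ∑ i ∈ R, x i
      ≤ (B.card + 1) * R.card - 1) :
    x ∈ convexHull ℝ K := by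
  classical
  have hR1 : 1 ≤ R.card := hR.card_pos
  have hull₁ : ∀ v : ι → ℝ, (∀ i, 0 ≤ v i ∧ v i ≤ 1) → ∑ i ∈ B, v i + 1 ≤ B.card →
      v ∈ convexHull ℝ K := by
    intro v hv hs
    have hB : 1 ≤ B.card := by
      have := Finset.sum_nonneg fun i (_ : i ∈ B) => (hv i).1
      exact_mod_cast (by linarith : (1 : ℝ) ≤ B.card)
    refine convexHull_mono ?_ (cardinalityPolytope_subset_convexHull B ∅ (B.card - 1)
      ⟨hv, by simp, ?_⟩)
    · rintro y ⟨hy, -, hy'⟩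
      refine hK₁ y hy ?_
      rw [Nat.cast_sub hB] at hy'
      push_cast at hy'; linarith
    · rw [Nat.cast_sub hB]; push_cast; linarith
  have hull₂ : ∀ v : ι → ℝ, (∀ i, 0 ≤ v i ∧ v i ≤ 1) → v e = 0 → ∑ i ∈ R, v i + 1 ≤ R.card →
      v ∈ convexHull ℝ K := by
    intro v hv he hs
    refine convexHull_mono ?_ (cardinalityPolytope_subset_convexHull R {e} (R.card - 1)
      ⟨hv, by simpa using he, ?_⟩)
    · rintro y ⟨hy, hye, hy'⟩
      refine hK₂ y hy (hye e (by simp)) ?_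
      rw [Nat.cast_sub hR1] at hy'
      push_cast at hy'; linarith
    · rw [Nat.cast_sub hR1]; push_cast; linarith
  have hull₃ : ∀ v : ι → ℝ, (∀ i, 0 ≤ v i ∧ v i ≤ 1) → (∀ i ∈ R, v i = 0) →
      v ∈ convexHull ℝ K := by
    intro v hv hs
    refine convexHull_mono ?_ (cardinalityPolytope_subset_convexHull ∅ R 0 ⟨hv, hs, by simp⟩)
    rintro y ⟨hy, hye, -⟩
    exact hK₃ y hy hye
  have hzero : (0 : ι → ℝ) ∈ convexHull ℝ K := hull₃ 0 (by simp) (by simp)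
  -- Deficiency of `x` on `B`. If it is at least 1, then `x` alone is of the first kind.
  obtain ⟨u, hu⟩ : ∃ u : ℝ, u = B.card - ∑ i ∈ B, x i := ⟨_, rfl⟩
  rcases le_or_gt 1 u with hu1 | hu1
  · exact hull₁ x hc (by linarith)
  have hBu : ∑ i ∈ B, (1 - x i) = u := by simp [hu]
  have hB1 : ∀ i ∈ B, 1 - x i ≤ u := fun i hi => by
    rw [← hBu]
    exact Finset.single_le_sum (f := fun i => 1 - x i) (fun j _ => by linarith [(hc j).2]) hi
  have hu0 : 0 ≤ u := by
    rw [← hBu]; exact Finset.sum_nonneg fun j _ => by linarith [(hc j).2]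
  have hX : ∑ i ∈ B, x i = B.card - u := by linarith
  rw [hX] at h₁ h₂ h₃
  -- The first point has weight `u`, so it carries at most `u` of any coordinate; `a` and `b j` are
  -- the excesses left for the other two points.
  obtain ⟨a, ha⟩ : ∃ a : ℝ, a = max 0 (x e - u) := ⟨_, rfl⟩
  obtain ⟨b, hb⟩ : ∃ b : ι → ℝ, ∀ j, b j = max 0 (x j - u) := ⟨_, fun _ => rfl⟩
  have ha0 : 0 ≤ a := ha ▸ le_max_left _ _
  have hau : x e - u ≤ a := ha ▸ le_max_right _ _
  have hax : a ≤ x e := by rw [ha]; exact max_le (hc e).1 (by linarith)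
  have has : a ≤ 1 - u := by rw [ha]; exact max_le (by linarith) (by linarith [(hc e).2])
  have hb0 : ∀ j, 0 ≤ b j := fun j => hb j ▸ le_max_left _ _
  have hbu : ∀ j, x j - u ≤ b j := fun j => hb j ▸ le_max_right _ _
  have hbx : ∀ j, b j ≤ x j := fun j => by
    rw [hb]; exact max_le (hc j).1 (by linarith)
  -- If `a = 0`, this is `x j ≤ 1`; otherwise it is the cover inequality for `j`.
  have hbs : ∀ j ∈ R, b j ≤ 1 - u - a := fun j hj => by
    have := h₁ j hj
    have := (hc j).2
    rw [hb]
    refine max_le (by linarith) ?_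
    rcases max_choice 0 (x e - u) with h | h <;> rw [h] at ha <;> linarith
  -- The cardinality bound for `w`, scaled by its weight. If no `x j` is below `u`, it is `h₂` when
  -- `a = 0` and `h₃` when `a = x e - u`. Otherwise some `b l` is zero and the other `|R| - 1` terms
  -- are bounded one by one.
  have hbsum : ∑ j ∈ R, b j ≤ (R.card - 1) * (1 - u - a) := by
    by_cases hall : ∀ j ∈ R, u ≤ x j
    · have : ∑ j ∈ R, b j = ∑ j ∈ R, x j - R.card * u := by
        rw [Finset.sum_congr rfl fun j hj => (hb j).trans
          (max_eq_right (by linarith [hall j hj]))]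
        simp
      rw [this]
      rcases max_choice 0 (x e - u) with h | h <;> rw [h] at ha <;> rw [ha] <;> nlinarith
    · push Not at hall
      obtain ⟨l, hl, hlu⟩ := hall
      rw [← Finset.add_sum_erase _ _ hl, hb l, max_eq_left (by linarith), zero_add]
      calc ∑ j ∈ R.erase l, b j ≤ ∑ j ∈ R.erase l, (1 - u - a) :=
            Finset.sum_le_sum fun j hj => hbs j (Finset.mem_of_mem_erase hj)
        _ = (R.card - 1) * (1 - u - a) := by
            rw [Finset.sum_const, Finset.card_erase_of_mem hl, nsmul_eq_mul, Nat.cast_sub hR1]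
            simp
  obtain ⟨t, ht⟩ : ∃ t : ℝ, t = 1 - u - a := ⟨_, rfl⟩
  rw [← ht] at hbs hbsum
  have ht0 : 0 ≤ t := by linarith
  -- The identity is for `u * v` so that weight zero is allowed; then every prescribed value is zero
  -- and `0` serves as `v`.
  have hmem₁ : ∃ v ∈ convexHull ℝ K, ∀ i, u * v i =
      if i ∈ B then u - (1 - x i) else if i = e then x e - a else
        if i ∈ R then x i - b i else u * x i := by
    rcases hu0.eq_or_lt with h0 | hpos
    · refine ⟨0, hzero, fun i => ?_⟩
      rw [← h0] at hB1 hau hbu ⊢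
      have := hc i
      simp only [Pi.zero_apply, mul_zero, zero_mul]
      split_ifs with h1 h2 h3
      · linarith [hB1 i h1]
      · linarith
      · linarith [hbu i, hbx i]
      · rfl
    · refine ⟨fun i => (if i ∈ B then u - (1 - x i) else if i = e then x e - a else
        if i ∈ R then x i - b i else u * x i) / u, hull₁ _ (fun i => ?_) ?_, fun i => ?_⟩
      · rw [le_div_iff₀ hpos, div_le_iff₀ hpos]
        have := hc i
        split_ifs with h1 h2 h3
        · constructor <;> linarith [hB1 i h1]
        · constructor <;> linarith
        · constructor <;> linarith [hbu i, hbx i]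
        · constructor <;> nlinarith
      · rw [← Finset.sum_div, Finset.sum_congr rfl fun i hi => if_pos hi, Finset.sum_sub_distrib,
          hBu, Finset.sum_const, nsmul_eq_mul]
        field_simp
        linarith
      · field_simp
  have hmem₂ : ∃ v ∈ convexHull ℝ K, ∀ i, t * v i =
      if i ∈ R then b i else if i = e then 0 else if i ∈ B then t else t * x i := by
    rcases ht0.eq_or_lt with h0 | hpos
    · refine ⟨0, hzero, fun i => ?_⟩
      rw [← h0] at hbs ⊢
      have := hb0 i
      simp only [Pi.zero_apply, mul_zero, zero_mul]
      split_ifs with h1 h2 h3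
      · linarith [hbs i h1]
      all_goals rfl
    · refine ⟨fun i => (if i ∈ R then b i else if i = e then 0 else if i ∈ B then t
        else t * x i) / t, hull₂ _ (fun i => ?_) ?_ ?_, fun i => ?_⟩
      · rw [le_div_iff₀ hpos, div_le_iff₀ hpos]
        have := hc i
        split_ifs with h1 h2 h3
        · constructor <;> linarith [hbs i h1, hb0 i]
        · constructor <;> linarith
        · constructor <;> linarith
        · constructor <;> nlinarith
      · simp [heR]
      · rw [← Finset.sum_div, Finset.sum_congr rfl fun i hi => if_pos hi, ← le_sub_iff_add_le,
          div_le_iff₀ hpos]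
        exact hbsum
      · field_simp
  obtain ⟨v, hv, hv'⟩ := hmem₁
  obtain ⟨w, hw, hw'⟩ := hmem₂
  have hz : (fun i => if i ∈ R then 0 else if i = e then 1 else if i ∈ B then 1 else x i)
      ∈ convexHull ℝ K := by
    refine hull₃ _ (fun i => ?_) fun i hi => by simp [hi]
    have := hc i
    split_ifs <;> constructor <;> linarith
  have hcomb := (convex_convexHull ℝ K).sum_mem (t := Finset.univ) (w := ![u, t, a])
    (z := ![v, w, fun i => if i ∈ R then 0 else if i = e then 1 else if i ∈ B then 1 else x i])
    (by intro i _; fin_cases i <;> simpa) (by simp [Fin.sum_univ_three]; linarith)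
    (by intro i _; fin_cases i <;> simpa)
  convert hcomb using 1
  ext i
  simp only [Fin.sum_univ_three, Matrix.cons_val, Pi.add_apply, Pi.smul_apply, smul_eq_mul, hv',
    hw']
  by_cases h1 : i ∈ B
  · have h2 : i ∉ R := Finset.disjoint_left.1 hBR h1
    have h3 : i ≠ e := fun h => heB (h ▸ h1)
    simp [h1, h2, h3]; linarith
  · by_cases h2 : i = e
    · subst h2; simp [heR, heB]
    · by_cases h3 : i ∈ R
      · simp [h1, h2, h3]
      · simp [h1, h2, h3, ht]; ring

theorem exists_eq_zero_of_sum_lt_card {ι : Type*} {x : ι → ℝ} (hx : ∀ i, x i = 0 ∨ x i = 1)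
    {S : Finset ι} (hS : ∑ i ∈ S, x i + 1 ≤ S.card) : ∃ i ∈ S, x i = 0 := by
  by_contra! h
  rw [Finset.sum_congr rfl fun i hi => (hx i).resolve_left (h i hi)] at hS
  simp at hS
  linarith

theorem sum_add_one_le_card {ι : Type*} {x : ι → ℝ} (hx : ∀ i, x i ≤ 1)
    {S : Finset ι} {i : ι} (hi : i ∈ S) (h0 : x i = 0) : ∑ j ∈ S, x j + 1 ≤ S.card := by
  classical
  have h := Finset.sum_le_card_nsmul (S.erase i) x 1 fun j _ => hx j
  rw [Finset.card_erase_of_mem hi, nsmul_eq_mul, Nat.cast_sub (Finset.card_pos.2 ⟨i, hi⟩)] at h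
  rw [← Finset.add_sum_erase _ _ hi, h0]
  push_cast at h
  linarith

/-- The convex hull of the `0/1` points that vanish somewhere on `B ∪ R` and, for every `j ∈ R`,
somewhere on `B ∪ {e, j}`. -/
theorem convexHull_eq_of_covers {ι : Type*} [Fintype ι] {K : Set (ι → ℝ)}
    (B R : Finset ι) (e : ι) (heB : e ∉ B) (heR : e ∉ R) (hBR : Disjoint B R) (hR : R.Nonempty)
    (hK : ∀ x : ι → ℝ, x ∈ K ↔ (∀ i, x i = 0 ∨ x i = 1) ∧
      ((∃ i ∈ B, x i = 0) ∨ ∃ i ∈ R, x i = 0) ∧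
      ∀ j ∈ R, (∃ i ∈ B, x i = 0) ∨ x e = 0 ∨ x j = 0) :
    convexHull ℝ K = {x : ι → ℝ | (∀ i, 0 ≤ x i ∧ x i ≤ 1) ∧
      (∀ j ∈ R, ∑ i ∈ B, x i + x e + x j ≤ B.card + 1) ∧
      ∑ i ∈ B, x i + ∑ i ∈ R, x i ≤ B.card + R.card - 1 ∧
      R.card * ∑ i ∈ B, x i + (R.card - 1) * x e + ∑ i ∈ R, x i
        ≤ (B.card + 1) * R.card - 1} := by
  have hR1 : (1 : ℝ) ≤ R.card := by exact_mod_cast hR.card_pos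
  refine (convexHull_min ?_ ?_).antisymm ?_
  · intro x hx
    obtain ⟨h01, hD, hC⟩ := (hK x).1 hx
    have hc : ∀ i, 0 ≤ x i ∧ x i ≤ 1 := fun i => by rcases h01 i with h | h <;> simp [h]
    have hsB : ∑ i ∈ B, x i ≤ B.card := by
      simpa using Finset.sum_le_card_nsmul B x 1 fun i _ => (hc i).2
    have hsR : ∑ i ∈ R, x i ≤ R.card := by
      simpa using Finset.sum_le_card_nsmul R x 1 fun i _ => (hc i).2
    have he := hc e
    by_cases hB : ∃ i ∈ B, x i = 0
    · obtain ⟨i, hi, h0⟩ := hB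
      have := sum_add_one_le_card (fun i => (hc i).2) hi h0
      refine ⟨hc, fun j _ => by linarith [hc j], by linarith, ?_⟩
      nlinarith
    -- With no zero in `B`, either `x e = 0` or all of `R` vanishes.
    · simp only [hB, false_or] at hD hC
      obtain ⟨i, hi, h0⟩ := hD
      have := sum_add_one_le_card (fun i => (hc i).2) hi h0
      refine ⟨hc, fun j hj => ?_, by linarith, ?_⟩
      · rcases hC j hj with h | h <;> linarith [hc j]
      · by_cases h : x e = 0
        · rw [h]; nlinarith
        · rw [Finset.sum_eq_zero fun j hj => (hC j hj).resolve_left h]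
          nlinarith
  · rintro x ⟨hx, hx₁, hx₂, hx₃⟩ y ⟨hy, hy₁, hy₂, hy₃⟩ a b ha hb hab
    obtain rfl : a = 1 - b := by linarith
    refine ⟨fun i => convex_Icc (0 : ℝ) 1 (hx i) (hy i) ha hb hab, fun j hj => ?_, ?_, ?_⟩ <;>
      simp only [Pi.add_apply, Pi.smul_apply, smul_eq_mul, Finset.sum_add_distrib,
        ← Finset.mul_sum]
    · linarith [mul_le_mul_of_nonneg_left (hx₁ j hj) ha, mul_le_mul_of_nonneg_left (hy₁ j hj) hb]
    · linarith [mul_le_mul_of_nonneg_left hx₂ ha, mul_le_mul_of_nonneg_left hy₂ hb]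
    · linarith [mul_le_mul_of_nonneg_left hx₃ ha, mul_le_mul_of_nonneg_left hy₃ hb]
  · rintro x ⟨hc, h₁, h₂, h₃⟩
    refine mem_convexHull_of_threeKinds B R e heB heR hBR hR ?_ ?_ ?_ x hc h₁ h₂ h₃
    · intro y hy hs
      have := exists_eq_zero_of_sum_lt_card hy hs
      exact (hK y).2 ⟨hy, .inl this, fun j _ => .inl this⟩
    · intro y hy he hs
      exact (hK y).2 ⟨hy, .inr (exists_eq_zero_of_sum_lt_card hy hs), fun j _ => .inr (.inl he)⟩
    · intro y hy hs
      obtain ⟨j, hj⟩ := hR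
      exact (hK y).2 ⟨hy, .inr ⟨j, hj, hs j hj⟩, fun j hj => .inr (.inr (hs j hj))⟩

/-! ### Membership in a TOMKS through its minimal covers. -/

theorem IsTOMKS.zero_or_one {n : ℕ} {K : Set (Fin n → ℝ)} (hK : IsTOMKS K) {x : Fin n → ℝ}
    (hx : x ∈ K) (i : Fin n) : x i = 0 ∨ x i = 1 := by
  obtain ⟨m, A, b, -, rfl⟩ := hK
  exact hx.1 i

/-- Nonnegative matrix entries make every row sum grow with the set. -/
theorem IsTOMKS.isCover_mono {n : ℕ} {K : Set (Fin n → ℝ)} (hK : IsTOMKS K)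
    {S T : Finset (Fin n)} (hST : S ⊆ T) (hS : IsCover K S) : IsCover K T := by
  obtain ⟨m, A, b, -, rfl⟩ := hK
  contrapose! hS
  simp only [IsCover, not_not, Set.mem_ofPred_eq] at hS ⊢
  refine ⟨fun i => ?_, fun r => le_trans ?_ (hS.2 r)⟩
  · unfold incidence; split_ifs <;> simp
  · refine Finset.sum_le_sum fun i _ => mul_le_mul_of_nonneg_left ?_ (Nat.cast_nonneg _)
    unfold incidence
    split_ifs with h1 h2
    · rfl
    · exact absurd (hST h1) h2
    · simp
    · rfl

theorem IsTOMKS.isCover_iff {n : ℕ} {K : Set (Fin n → ℝ)} (hK : IsTOMKS K)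
    {S : Finset (Fin n)} : IsCover K S ↔ ∃ C ∈ minimalCoverSet K, C ⊆ S := by
  constructor
  · intro hS
    obtain ⟨C, hCS, hC⟩ := (Set.toFinite {T | IsCover K T}).exists_le_minimal hS
    exact ⟨C, hC, hCS⟩
  · rintro ⟨C, hC, hCS⟩
    exact hK.isCover_mono hCS hC.1

theorem IsTOMKS.mem_iff {n : ℕ} {K : Set (Fin n → ℝ)} (hK : IsTOMKS K) (x : Fin n → ℝ) :
    x ∈ K ↔ (∀ i, x i = 0 ∨ x i = 1) ∧ ∀ C ∈ minimalCoverSet K, ∃ i ∈ C, x i = 0 := by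
  by_cases hx : ∀ i, x i = 0 ∨ x i = 1
  · have hinc : incidence (Finset.univ.filter fun i => x i = 1) = x := by
      ext i
      rcases hx i with h | h <;> simp [incidence, h]
    have := hK.isCover_iff (S := Finset.univ.filter fun i => x i = 1)
    rw [IsCover, hinc] at this
    rw [← not_iff_not, this]
    simp only [hx, implies_true, true_and, not_forall, not_exists, not_and, exists_prop]
    refine exists_congr fun C => and_congr_right fun _ => ?_
    simp only [Finset.subset_iff, Finset.mem_filter, Finset.mem_univ, true_and]
    exact forall₂_congr fun i _ => ⟨fun h => by simp [h], (hx i).resolve_left⟩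
  · simp only [hx, false_and, iff_false]
    exact fun h => hx (hK.zero_or_one h)

/-! ### Index blocks, coefficients and the multi-cover. -/

theorem mem_block {n a b : ℕ} {i : Fin n} : i ∈ (block a b : Finset (Fin n)) ↔
    a ≤ (i : ℕ) + 1 ∧ (i : ℕ) + 1 ≤ b := by
  simp [block]

theorem card_block {n a b : ℕ} (ha : 1 ≤ a) (hb : b ≤ n) :
    (block a b : Finset (Fin n)).card = b + 1 - a := by
  rw [← Nat.card_Icc]
  refine Finset.card_bij (fun i _ => (i : ℕ) + 1) (fun i hi => ?_) (fun i _ j _ h => ?_) ?_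
  · simpa using mem_block.1 hi
  · exact Fin.ext (by omega)
  · intro k hk
    rw [Finset.mem_Icc] at hk
    exact ⟨⟨k - 1, by omega⟩, mem_block.2 (by simp; omega), by simp; omega⟩

theorem block_self {n p : ℕ} (hp : 1 ≤ p) (hpn : p ≤ n) :
    (block p p : Finset (Fin n)) = {⟨p - 1, by omega⟩} := by
  ext i
  rw [mem_block, Finset.mem_singleton, Fin.ext_iff]
  simp only
  omega

theorem dominates_of_subset {n : ℕ} {S T : Finset (Fin n)} (h : T ⊆ S) : Dominates S T :=
  ⟨fun i => ⟨i, h i.2⟩, fun i j hij => Subtype.ext (by simpa using hij), fun _ => le_rfl⟩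

/-- The coefficients of `mciForm`. -/
def mciCoeff {n : ℕ} (p q : ℕ) (i : Fin n) : ℕ :=
  if (i : ℕ) + 1 < p then q - p else if (i : ℕ) + 1 = p then q - p - 1
    else if (i : ℕ) + 1 ≤ q then 1 else 0

theorem sum_mciCoeff {n p q : ℕ} (hp : 1 ≤ p) (hpq : p + 1 ≤ q) (x : Fin n → ℝ) :
    ∑ i, (mciCoeff p q i : ℝ) * x i = mciForm p q x := by
  have h : ∀ i : Fin n, (mciCoeff p q i : ℝ) * x i =
      ((q : ℝ) - p) * (if 1 ≤ (i : ℕ) + 1 ∧ (i : ℕ) + 1 ≤ p - 1 then x i else 0) +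
      ((q : ℝ) - p - 1) * (if p ≤ (i : ℕ) + 1 ∧ (i : ℕ) + 1 ≤ p then x i else 0) +
      (if p + 1 ≤ (i : ℕ) + 1 ∧ (i : ℕ) + 1 ≤ q then x i else 0) := by
    intro i
    have hc : ((q - p : ℕ) : ℝ) = q - p := Nat.cast_sub (by omega)
    have hc' : ((q - p - 1 : ℕ) : ℝ) = q - p - 1 := by
      rw [Nat.cast_sub (by omega), hc, Nat.cast_one]
    unfold mciCoeff
    split_ifs <;> first | omega | simp [hc, hc']
  rw [Finset.sum_congr rfl fun i _ => h i, Finset.sum_add_distrib, Finset.sum_add_distrib,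
    ← Finset.mul_sum, ← Finset.mul_sum]
  simp only [mciForm, block, Finset.sum_filter]

theorem sum_mciCoeff_block {n p q a b c : ℕ} (ha : 1 ≤ a) (hb : b ≤ n)
    (h : ∀ i : Fin n, a ≤ (i : ℕ) + 1 → (i : ℕ) + 1 ≤ b → mciCoeff p q i = c) :
    ∑ i ∈ (block a b : Finset (Fin n)), mciCoeff p q i = (b + 1 - a) * c := by
  rw [Finset.sum_congr rfl fun i hi => h i (mem_block.1 hi).1 (mem_block.1 hi).2,
    Finset.sum_const, card_block ha hb, smul_eq_mul]

/-- The multi-cover is made of `{1, …, p - 1, p + 1, …, q}` and `{1, …, p, q}`. -/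
theorem isMCI_mciCoeff {n p q : ℕ} (hp : 1 ≤ p) (hpq : p + 3 ≤ q) (hqn : q ≤ n)
    {K : Set (Fin n → ℝ)} (hD : IsCover K (block 1 (p - 1) ∪ block (p + 1) q))
    (hC : IsCover K (block 1 p ∪ {⟨q - 1, by omega⟩})) :
    IsMCI K (mciCoeff p q) ((p : ℤ) * ((q : ℤ) - p) - 1) := by
  obtain ⟨D, hDdef⟩ : ∃ D : Finset (Fin n), D = block 1 (p - 1) ∪ block (p + 1) q := ⟨_, rfl⟩
  obtain ⟨C, hCdef⟩ : ∃ C : Finset (Fin n), C = block 1 p ∪ {⟨q - 1, by omega⟩} := ⟨_, rfl⟩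
  rw [← hDdef] at hD
  rw [← hCdef] at hC
  have memD : ∀ i, i ∈ D ↔ (i : ℕ) + 1 ≤ q ∧ (i : ℕ) + 1 ≠ p := fun i => by
    rw [hDdef, Finset.mem_union, mem_block, mem_block]; omega
  have memC : ∀ i, i ∈ C ↔ (i : ℕ) + 1 ≤ p ∨ (i : ℕ) + 1 = q := fun i => by
    rw [hCdef, Finset.mem_union, mem_block, Finset.mem_singleton, Fin.ext_iff]
    simp only
    omega
  have memI : ∀ i, i ∈ familyInter {D, C} ↔ (i : ℕ) + 1 < p ∨ (i : ℕ) + 1 = q := fun i => by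
    simp only [familyInter, Finset.inf_insert, Finset.inf_singleton, id, Finset.inf_eq_inter,
      Finset.mem_inter, memD, memC]
    omega
  have memU : ∀ i, i ∈ familyUnion {D, C} ↔ (i : ℕ) + 1 ≤ q := fun i => by
    simp only [familyUnion, Finset.sup_insert, Finset.sup_singleton, id, Finset.sup_eq_union,
      Finset.mem_union, memD, memC]
    omega
  have hdisc : discrepancyFamily {D, C} =
      {D \ familyInter {D, C}, C \ familyInter {D, C}} := by
    simp [discrepancyFamily, Finset.image_insert]
  have hF : IsMultiCover K {D, C} := by
    refine ⟨⟨D, by simp⟩, by simp [hD, hC], fun T hT _ => ?_⟩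
    rw [hdisc] at hT ⊢
    have hT' : ∀ i ∈ T, p ≤ (i : ℕ) + 1 ∧ (i : ℕ) + 1 < q := fun i hi => by
      have := hT hi
      simp only [familyUnion, Finset.sup_insert, Finset.sup_singleton, id, Finset.sup_eq_union,
        Finset.mem_union, Finset.mem_sdiff, memD, memC, memI] at this
      omega
    -- The second discrepancy is `{p}`: `T` contains it, or else lies inside `{p+1, …, q-1}`, the
    -- first one.
    by_cases he : (⟨p - 1, by omega⟩ : Fin n) ∈ T
    · refine ⟨_, Finset.mem_insert_of_mem (Finset.mem_singleton_self _), .inl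
        (dominates_of_subset fun i hi => ?_)⟩
      rw [Finset.mem_sdiff, memC, memI] at hi
      convert he using 1
      ext
      simp only
      omega
    · refine ⟨_, Finset.mem_insert_self _ _, .inr (dominates_of_subset fun i hi => ?_)⟩
      have hne : (i : ℕ) + 1 ≠ p := fun h => he (by
        convert hi using 1
        ext
        simp only
        omega)
      rw [Finset.mem_sdiff, memD, memI]
      have := hT' i hi
      omega
  refine ⟨{D, C}, hF, fun i hi => ?_, fun i hi hmax => ?_, fun i hi _ => ?_, fun j hj => ?_, ?_⟩
  · rw [memU] at hi
    unfold mciCoeff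
    split_ifs <;> omega
  · rw [Finset.mem_sdiff, memU, memI] at hi
    -- The largest element of `C \ C₀` is the index `q - 1`, since `q` lies in both covers.
    have := hmax ⟨q - 2, by omega⟩ (by rw [Finset.mem_sdiff, memU, memI]; simp only; omega)
    rw [Fin.le_def] at this
    simp only at this
    unfold mciCoeff
    split_ifs <;> omega
  · rw [Finset.mem_sdiff, memU, memI] at hi
    have hpos : 1 ≤ mciCoeff p q i := by unfold mciCoeff; split_ifs <;> omega
    suffices h : ∀ E ∈ ({D, C} : Finset (Finset (Fin n))), i ∈ E →
        ∀ ℓ ∈ familyUnion {D, C} \ E, i < ℓ → mciCoeff p q ℓ ≤ mciCoeff p q i - 1 by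
      refine (Nat.le_sub_iff_add_le hpos).1 (Finset.sup_le fun E hE => Finset.sup_le fun ℓ hℓ => ?_)
      rw [Finset.mem_filter] at hE hℓ
      exact h E hE.1 hE.2 ℓ hℓ.1 hℓ.2
    intro E hE hiE ℓ hℓ hlt
    rw [Finset.mem_sdiff, memU] at hℓ
    rw [Fin.lt_def] at hlt
    simp only [Finset.mem_insert, Finset.mem_singleton] at hE
    rcases hE with rfl | rfl
    -- Only `p` is missing from this cover, and nothing in `C \ C₀` precedes it.
    · rw [memD] at hiE hℓ
      omega
    -- Here `i` is the index `p`, which must exceed coefficients equal to 1; `q - p - 1 ≥ 2` is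
    -- where `p + 3 ≤ q` enters.
    · rw [memC] at hiE hℓ
      unfold mciCoeff
      split_ifs <;> omega
  · rw [memI] at hj
    -- The cover `{1, …, p, q}` suffices to bound the minimum: its complement `{p+1, …, q-1}` has
    -- coefficient sum `q - p - 1`, giving `q - p` for `j < p`, while for `j = q` the bound is 1.
    refine (Finset.inf'_le _ (b := C) (by simp)).trans (max_le (Finset.sup_le fun ℓ hℓ => ?_) ?_)
    · rw [Finset.mem_filter, Finset.mem_sdiff, memU, memC, Fin.lt_def] at hℓ
      unfold mciCoeff
      split_ifs <;> omega
    · rcases hj with hj | hj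
      · have hsub : (familyUnion {D, C} \ C).filter (fun ℓ => j < ℓ) ⊆ block (p + 1) (q - 1) := by
          intro ℓ hℓ
          rw [Finset.mem_filter, Finset.mem_sdiff, memU, memC] at hℓ
          rw [mem_block]
          omega
        have h := Finset.sum_le_sum_of_subset (f := mciCoeff p q) hsub
        rw [sum_mciCoeff_block (c := 1) (by omega) (by omega) fun i h1 h2 => by
          unfold mciCoeff; split_ifs <;> omega] at h
        have : mciCoeff p q j = q - p := by unfold mciCoeff; split_ifs; rfl
        omega
      · rw [Finset.sum_eq_zero]
        · unfold mciCoeff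
          split_ifs <;> omega
        · intro ℓ hℓ
          rw [Finset.mem_filter, Finset.mem_sdiff, memU, Fin.lt_def] at hℓ
          omega
  · have hsumB : ∑ i ∈ (block 1 (p - 1) : Finset (Fin n)), mciCoeff p q i = (p - 1) * (q - p) := by
      rw [sum_mciCoeff_block (c := q - p) le_rfl (by omega) fun i h1 h2 => by
        unfold mciCoeff; split_ifs <;> omega, Nat.add_sub_cancel]
    have hpart : (p - 1) * (q - p) + (q - p) = p * (q - p) := by
      rw [← Nat.succ_mul]; congr 1; omega
    -- Both covers have the same weight `p (q - p)`, so the maximum defining `β` is attained by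
    -- each.
    have hsumD : ∑ i ∈ D, mciCoeff p q i = p * (q - p) := by
      rw [hDdef, Finset.sum_union, hsumB, sum_mciCoeff_block (c := 1) (by omega) hqn
        fun i h1 h2 => by unfold mciCoeff; split_ifs <;> omega]
      · rw [← hpart]; omega
      · rw [Finset.disjoint_left]
        intro i
        rw [mem_block, mem_block]
        omega
    have hsumC : ∑ i ∈ C, mciCoeff p q i = p * (q - p) := by
      have hCsplit : C = block 1 (p - 1) ∪ (block p p ∪ block q q) := by
        ext i
        simp only [memC, Finset.mem_union, mem_block]
        omega
      rw [hCsplit, Finset.sum_union, Finset.sum_union, hsumB,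
        sum_mciCoeff_block (c := q - p - 1) hp (by omega)
          fun i h1 h2 => by unfold mciCoeff; split_ifs <;> omega,
        sum_mciCoeff_block (c := 1) (by omega) hqn
          fun i h1 h2 => by unfold mciCoeff; split_ifs <;> omega, ← hpart]
      · simp only [Nat.add_sub_cancel_left]; omega
      all_goals
        rw [Finset.disjoint_left]
        intro i
        simp only [Finset.mem_union, mem_block]
        omega
    rw [Finset.sup_insert, Finset.sup_singleton, hsumD, hsumC, max_self, Nat.cast_mul,
      Nat.cast_sub (by omega)]

/-! ### Specialization to the blocks of indices. -/

theorem theorem4 (n p q : ℕ) (hp : 1 ≤ p) (hpq : p + 2 ≤ q) (hqn : q ≤ n)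
    (K : Set (Fin n → ℝ)) (hK : IsTOMKS K)
    (hcov : minimalCoverSet K =
      {block 1 (p - 1) ∪ block (p + 1) q} ∪
        {C | ∃ j ∈ (block (p + 1) q : Finset (Fin n)), C = block 1 p ∪ {j}}) :
    convexHull ℝ K =
      {x : Fin n → ℝ |
        (∀ i, 0 ≤ x i ∧ x i ≤ 1) ∧
        (∀ j ∈ (block (p + 1) q : Finset (Fin n)), (∑ i ∈ block 1 p, x i) + x j ≤ (p : ℝ)) ∧
        (∑ i ∈ block 1 (p - 1), x i) + (∑ i ∈ block (p + 1) q, x i) ≤ (q : ℝ) - 2 ∧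
        mciForm p q x ≤ (p : ℝ) * ((q : ℝ) - p) - 1} ∧
    (p + 3 ≤ q →
      ∃ α : Fin n → ℕ, IsMCI K α ((p : ℤ) * ((q : ℤ) - p) - 1) ∧
        ∀ x : Fin n → ℝ, ∑ i, (α i : ℝ) * x i = mciForm p q x) := by
  obtain ⟨e, he⟩ : ∃ e : Fin n, e = ⟨p - 1, by omega⟩ := ⟨_, rfl⟩
  have he' : (e : ℕ) + 1 = p := by rw [he]; simp only; omega
  have hsplit : (block 1 p : Finset (Fin n)) = insert e (block 1 (p - 1)) := by
    ext i
    rw [Finset.mem_insert, mem_block, mem_block, Fin.ext_iff]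
    omega
  have heB : e ∉ (block 1 (p - 1) : Finset (Fin n)) := by rw [mem_block]; omega
  refine ⟨?_, fun h3 => ⟨mciCoeff p q, isMCI_mciCoeff hp h3 hqn ?_ ?_,
    fun x => sum_mciCoeff hp (by omega) x⟩⟩
  · have hcB : ((block 1 (p - 1) : Finset (Fin n)).card : ℝ) = p - 1 := by
      rw [card_block le_rfl (by omega), Nat.add_sub_cancel, Nat.cast_sub hp, Nat.cast_one]
    have hcR : ((block (p + 1) q : Finset (Fin n)).card : ℝ) = q - p := by
      rw [card_block (by omega) hqn, Nat.add_sub_add_right, Nat.cast_sub (by omega)]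
    rw [convexHull_eq_of_covers (block 1 (p - 1)) (block (p + 1) q) e heB
      (by rw [mem_block]; omega) ?_ ⟨⟨q - 1, by omega⟩, by rw [mem_block]; simp only; omega⟩ ?_]
    · ext x
      simp only [Set.mem_ofPred_eq, hcB, hcR, mciForm, hsplit, Finset.sum_insert heB,
        block_self hp (by omega : p ≤ n), ← he, Finset.sum_singleton]
      refine and_congr_right fun _ => and_congr (forall₂_congr fun j _ => ?_)
        (and_congr ?_ ?_)
      · rw [sub_add_cancel, add_comm (x e)]
      · rw [show (p : ℝ) - 1 + (q - p) - 1 = q - 2 by ring]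
      · rw [sub_add_cancel]
    · rw [Finset.disjoint_left]
      intro i
      rw [mem_block, mem_block]
      omega
    · intro x
      rw [hK.mem_iff, hcov]
      refine and_congr_right fun _ => ?_
      simp only [Set.singleton_union, Set.mem_insert_iff, Set.mem_ofPred_eq, forall_eq_or_imp,
        forall_exists_index, and_imp, hsplit]
      refine and_congr (by simp only [Finset.mem_union, or_and_right, exists_or]) ⟨fun h j hj => ?_, fun h C j hj hC => ?_⟩
      · have := h _ j hj rfl
        simp only [Finset.mem_union, Finset.mem_insert, Finset.mem_singleton, or_and_right,
          exists_or, exists_eq_left] at this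
        rwa [or_assoc, or_left_comm] at this
      · subst hC
        have := h j hj
        simp only [Finset.mem_union, Finset.mem_insert, Finset.mem_singleton, or_and_right,
          exists_or, exists_eq_left]
        rwa [or_assoc, or_left_comm]
  · exact hK.isCover_iff.2 ⟨_, by rw [hcov]; exact .inl rfl, subset_rfl⟩
  · refine hK.isCover_iff.2 ⟨_, by
      rw [hcov]
      exact .inr ⟨⟨q - 1, by omega⟩, by rw [mem_block]; simp only; omega, rfl⟩, subset_rfl⟩
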